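/- All graphs are finite and simple, and $d$ denotes the graph distance. For a graph $G$, an exact $r$-coloring is a surjection $c:V(G)\to\{1,\dots,r\}$; a $3$-term arithmetic progression ($3$-AP) in $G$ is a list $(v_1,v_2,v_3)$ of vertices with $d(v_1,v_2)=d(v_2,v_3)$, and it is rainbow if its three vertices receive pairwise distinct colors. The anti-van der Waerden number $\mathrm{aw}(G,3)$ is the least positive integer $r$ such that every exact $r$-coloring of $G$ contains a rainbow $3$-AP. A vertex is peripheral if its eccentricity equals $\mathrm{diam}(G)$; $G$ is $3$-peripheral if it has three distinct vertices at pairwise distance $\mathrm{diam}(G)$, and non-$3$-peripheral otherwise. For a tree $T$ and a peripheral vertex $v$, let $T_{v^-}$ be the tree obtained from $T$ by removing all vertices at distance $\mathrm{diam}(T)$ from $v$; for any vertex $v$, let $T_{v^+}$ be the tree obtained from $T$ by adding a new leaf adjacent to $v$. Let $T$ be a nontrivial (at least two vertices) non-$3$-peripheral tree. If $\mathrm{diam}(T)$ is odd, $T$ is strongly non-$3$-peripheral if $T_{v^-}$ is non-$3$-peripheral for some peripheral vertex $v$, and weakly non-$3$-peripheral otherwise. If $\mathrm{diam}(T)$ is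 even, $T$ is strongly non-$3$-peripheral if $T_{v^+}$ is non-$3$-peripheral for every vertex $v$, and weakly non-$3$-peripheral otherwise. **Theorem.** Let $T$ and $T'$ be nontrivial trees such that the diameter of the Cartesian product $T\square T'$ is even. Then \[ \mathrm{aw}(T\square T',3)=\begin{cases}3 & \text{if $T$ or $T'$ is weakly non-$3$-peripheral or isomorphic to $P_2$,}\\ 4 & \text{if $T$ and $T'$ are both strongly non-$3$-peripheral and neither is isomorphic to $P_2$,}\end{cases} \] where $P_2$ is the path on two vertices. -/

import Mathlib

namespace AntiVdW

/-- The list `v 0, …, v (k - 1)` of vertices is a `k`-term arithmetic progression of `G`: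
consecutive vertices are all at the same (finite) distance `d`, the common difference. -/
def IsAP {V : Type*} (G : SimpleGraph V) {k : ℕ} (v : Fin k → V) : Prop :=
  ∃ d : ℕ, ∀ i j : Fin k, (j : ℕ) = (i : ℕ) + 1 → G.edist (v i) (v j) = (d : ℕ∞)

/-- The coloring `c` of the vertices of `G` has a rainbow `k`-term arithmetic progression. -/
def HasRainbowAP {V C : Type*} (G : SimpleGraph V) (k : ℕ) (c : V → C) : Prop :=
  ∃ v : Fin k → V, IsAP G v ∧ Function.Injective (fun i => c (v i))

/-- The anti-van der Waerden number `aw(G, k)`: the least positive number `r` of colors such that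
every exact `r`-coloring (a surjection onto a set of `r` colors) of the vertices of `G` has a
rainbow `k`-term arithmetic progression. For a finite graph such an `r` exists, since there is no
exact `r`-coloring with `r` greater than the number of vertices. -/
noncomputable def aw {V : Type*} (G : SimpleGraph V) (k : ℕ) : ℕ :=
  sInf {r : ℕ | 1 ≤ r ∧ ∀ c : V → Fin r, Function.Surjective c → HasRainbowAP G k c}

/-- A vertex is peripheral if its eccentricity is the diameter of the graph. -/
def IsPeripheralVertex {V : Type*} (G : SimpleGraph V) (v : V) : Prop :=
  G.eccent v = G.ediam

/-- `G` is `n`-peripheral: it has `n` distinct vertices at pairwise distance `diam G`. -/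
def IsPeripheral {V : Type*} (G : SimpleGraph V) (n : ℕ) : Prop :=
  ∃ u : Fin n → V, Function.Injective u ∧ ∀ i j : Fin n, i ≠ j → G.dist (u i) (u j) = G.diam

/-- `T_{v⁻}`: remove from `T` all vertices which realize the diameter of `T` with `v`. -/
def removeFar {V : Type*} (T : SimpleGraph V) (v : V) :
    SimpleGraph {w : V | T.dist v w ≠ T.diam} :=
  T.induce {w : V | T.dist v w ≠ T.diam}

/-- `T_{u⁺}`: the graph `T` with an additional leaf (the vertex `none`) adjacent to `u`. -/
def addLeaf {V : Type*} (T : SimpleGraph V) (u : V) : SimpleGraph (Option V) where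
  Adj
    | some a, some b => T.Adj a b
    | some a, none => a = u
    | none, some b => b = u
    | none, none => False
  symm := ⟨fun a b h => by
    cases a <;> cases b <;> first | exact h | exact T.adj_symm h⟩
  loopless := ⟨fun a h => by
    cases a
    · exact h
    · exact T.irrefl h⟩

/-- Strongly non-`3`-peripheral (used for nontrivial finite trees): non-`3`-peripheral, and
* if the diameter is odd, `T_{v⁻}` is non-`3`-peripheral for some peripheral vertex `v`;
* if the diameter is even, `T_{v⁺}` is non-`3`-peripheral for all vertices `v`. -/
def IsStronglyNonThreePeripheral {V : Type*} (T : SimpleGraph V) : Prop :=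
  ¬ IsPeripheral T 3 ∧
    (Odd T.diam → ∃ v : V, IsPeripheralVertex T v ∧ ¬ IsPeripheral (removeFar T v) 3) ∧
    (Even T.diam → ∀ v : V, ¬ IsPeripheral (addLeaf T v) 3)

/-- Weakly non-`3`-peripheral (used for nontrivial finite trees): non-`3`-peripheral, and
* if the diameter is odd, `T_{v⁻}` is `3`-peripheral for all peripheral vertices `v`;
* if the diameter is even, `T_{v⁺}` is `3`-peripheral for some vertex `v`. -/
def IsWeaklyNonThreePeripheral {V : Type*} (T : SimpleGraph V) : Prop :=
  ¬ IsPeripheral T 3 ∧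
    (Odd T.diam → ∀ v : V, IsPeripheralVertex T v → IsPeripheral (removeFar T v) 3) ∧
    (Even T.diam → ∃ v : V, IsPeripheral (addLeaf T v) 3)

/-- `T` is isomorphic to the path `P₂` on two vertices. -/
def IsP2 {V : Type*} (T : SimpleGraph V) : Prop :=
  Nonempty (T ≃g SimpleGraph.pathGraph 2)

end AntiVdW

namespace AntiVdW

/-! Distances in the product add, so the argument is about two metrics with geodesics, medians and
the four-point condition. Let a coloring with at least three colors have no rainbow progression. A
shortest walk through three colors straightens to a geodesic from `x` (color `α`) to `z` (color
`γ`), of odd length `m`, and every inner vertex of the interval between them has color `β`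
(`Extremal.color_between`). In the product, any vertex at distance `m` from one end may replace the
other end (`TricolorSetting.sphere`). Trading steps between the factors makes the pair diametral in
the first factor; walking it along the second factor then brings it too close to any vertex of a
fourth color (`TricolorSetting.eq_color`). This bounds the number by 4.

If the total diameter is even, the oddness of `m` leaves room for one more step in the second
factor. In a weak first factor, a vertex (almost) opposite to both ends uses this step to turn the
pair until `α` and `γ` are closer than `m` allows. In `P₂` the step moves the pair into a single
layer, which is impossible.

Strong factors have a bad 3-coloring. Let `D` be the total diameter and `(u, v)`, `(u', v')` be
built from strong pairs. Color red what is opposite to `(u', v')` in both coordinates, blue what is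
at distance `D - 1` from `(u, v)`, and the rest white. The vertices at distance `D - 1` from a red
vertex are exactly the blue ones, and vice versa, so a progression with red or blue middle is not
rainbow. A white middle between red and blue would make the odd number `D - 1` even. -/

/-- A `ℕ`-valued distance function with geodesics and medians (as in a median graph). -/
structure IsMedianDist {X : Type*} (d : X → X → ℕ) : Prop where
  self : ∀ x, d x x = 0
  eq_of_zero : ∀ {x y}, d x y = 0 → x = y
  symm : ∀ x y, d x y = d y x
  triangle : ∀ x y z, d x z ≤ d x y + d y z
  between : ∀ {x y s}, s ≤ d x y → ∃ z, d x z = s ∧ d z y = d x y - s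
  median : ∀ x y z, ∃ t, d x t + d t y = d x y ∧ d x t + d t z = d x z ∧ d y t + d t z = d y z

/-- A `ℕ`-valued distance function with geodesics and medians which satisfies the four-point
condition, as the distance of a tree does. -/
structure IsTreeDist {X : Type*} (d : X → X → ℕ) : Prop extends IsMedianDist d where
  fourPoint : ∀ x y z w, d x y + d z w ≤ max (d x z + d y w) (d x w + d y z)

/-- Through the median the sum is twice the total length of the three legs: a median metric is
bipartite. -/
theorem IsMedianDist.parity {X : Type*} {d : X → X → ℕ} (h : IsMedianDist d) (x y z : X) :
    Even (d x y + d x z + d y z) := by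
  obtain ⟨t, h1, h2, h3⟩ := h.median x y z
  have := h.symm t y
  exact ⟨d x t + d y t + d t z, by omega⟩

/-! ### The distance of a tree is median and satisfies the four-point condition -/

section Graph

open SimpleGraph

variable {V : Type*} {T : SimpleGraph V}

theorem length_eq_dist_of_isPath (hT : T.IsTree) {x y : V} {p : T.Walk x y} (hp : p.IsPath) :
    p.length = T.dist x y := by
  obtain ⟨q, hq, hl⟩ := hT.connected.exists_path_of_dist x y
  have := (hT.isAcyclic.subsingleton_path x y).elim ⟨p, hp⟩ ⟨q, hq⟩
  simp only [Subtype.mk.injEq] at this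
  rw [this, hl]

theorem isPath_append {x y z : V} {p : T.Walk x y} {q : T.Walk y z} (hp : p.IsPath)
    (hq : q.IsPath) (h : ∀ v ∈ p.support, v ∈ q.support → v = y) : (p.append q).IsPath := by
  rw [Walk.isPath_def, Walk.support_append, List.nodup_append']
  refine ⟨hp.support_nodup, hq.support_nodup.tail, ?_⟩
  intro v hv hv'
  have hvy := h v hv (List.mem_of_mem_tail hv')
  subst hvy
  have := hq.support_nodup
  rw [← Walk.cons_tail_support] at this
  exact (List.nodup_cons.1 this).1 hv'

theorem dist_getVert_le {x y : V} (p : T.Walk x y) {s t : ℕ} (h : s ≤ t) :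
    T.dist (p.getVert s) (p.getVert t) ≤ t - s := by
  have hq := dist_le ((p.drop s).take (t - s))
  rw [Walk.take_length, Walk.drop_getVert, Nat.add_sub_cancel' h] at hq
  exact hq.trans (min_le_left _ _)

/-- The projection of a vertex to a path of a tree. -/
theorem exists_gate (hT : T.IsTree) {x y : V} {p : T.Walk x y} (hp : p.IsPath) (z : V) :
    ∃ v ∈ p.support, T.dist x v + T.dist v z = T.dist x z ∧
      T.dist y v + T.dist v z = T.dist y z := by
  classical
  obtain ⟨v, hv, hmin⟩ := p.support.toFinset.exists_min_image (fun v => T.dist v z)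
    ⟨x, by simp⟩
  simp only [List.mem_toFinset] at hv hmin
  -- As `v` is nearest to `z` on `p`, the path `q` meets `p` only in `v`; joining it to either half
  -- of `p` gives a path, hence a geodesic.
  obtain ⟨q, hq, hql⟩ := hT.connected.exists_path_of_dist v z
  have key : ∀ w ∈ p.support, w ∈ q.support → w = v := by
    intro w hw hw'
    have h1 := hmin w hw
    have h2 := length_eq_dist_of_isPath hT (hq.takeUntil hw')
    have h3 := length_eq_dist_of_isPath hT (hq.dropUntil hw')
    have h4 := congrArg Walk.length (q.take_spec hw')
    rw [Walk.length_append] at h4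
    exact ((hT.connected.dist_eq_zero_iff).1 (by omega)).symm
  refine ⟨v, hv, ?_, ?_⟩
  · have h := length_eq_dist_of_isPath hT (isPath_append (hp.takeUntil hv) hq
      fun w hw hw' => key w (p.support_takeUntil_subset_support hv hw) hw')
    rw [Walk.length_append, length_eq_dist_of_isPath hT (hp.takeUntil hv), hql] at h
    exact h
  · have h := length_eq_dist_of_isPath hT (isPath_append (hp.dropUntil hv).reverse hq
      fun w hw hw' => key w (p.support_dropUntil_subset_support hv (by simpa using hw)) hw')
    rw [Walk.length_append, length_eq_dist_of_isPath hT (hp.dropUntil hv).reverse, hql] at h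
    exact h

theorem IsMedianDist.dist_of_isTree (hT : T.IsTree) : IsMedianDist T.dist where
  self x := dist_self
  eq_of_zero h := hT.connected.dist_eq_zero_iff.1 h
  symm x y := dist_comm
  triangle x y z := hT.connected.dist_triangle
  between {x y s} hs := by
    obtain ⟨p, hp, hl⟩ := hT.connected.exists_path_of_dist x y
    refine ⟨p.getVert s, ?_⟩
    have h1 := dist_getVert_le p (Nat.zero_le s)
    have h2 := dist_getVert_le p (hl ▸ hs)
    have h3 : T.dist x y ≤ _ := hT.connected.dist_triangle (v := p.getVert s)
    simp only [Walk.getVert_zero, Walk.getVert_length] at h1 h2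
    omega
  median x y z := by
    obtain ⟨p, hp, hl⟩ := hT.connected.exists_path_of_dist x y
    obtain ⟨v, hv, h1, h2⟩ := exists_gate hT hp z
    classical
    have h3 := length_eq_dist_of_isPath hT (hp.takeUntil hv)
    have h4 := length_eq_dist_of_isPath hT (hp.dropUntil hv)
    have h5 := congrArg Walk.length (p.take_spec hv)
    rw [Walk.length_append] at h5
    exact ⟨v, by omega, h1, h2⟩

theorem IsTreeDist.dist_of_isTree (hT : T.IsTree) : IsTreeDist T.dist where
  toIsMedianDist := .dist_of_isTree hT
  fourPoint x y z w := by
    have hM := IsMedianDist.dist_of_isTree hT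
    obtain ⟨p, hp, hl⟩ := hT.connected.exists_path_of_dist x y
    obtain ⟨a, ha, h1, h2⟩ := exists_gate hT hp z
    obtain ⟨b, hb, h3, h4⟩ := exists_gate hT hp w
    obtain ⟨s, rfl, hs⟩ := Walk.mem_support_iff_exists_getVert.1 ha
    obtain ⟨t, rfl, ht⟩ := Walk.mem_support_iff_exists_getVert.1 hb
    have e1 := dist_getVert_le p (Nat.zero_le s)
    have e2 := dist_getVert_le p (Nat.zero_le t)
    have e3 := dist_getVert_le p hs
    have e4 := dist_getVert_le p ht
    have e5 := hM.triangle x (p.getVert s) y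
    have e6 := hM.triangle x (p.getVert t) y
    have e7 := hM.triangle z (p.getVert s) w
    have e8 := hM.triangle (p.getVert s) (p.getVert t) w
    rw [hM.symm y, hM.symm y] at h2 h4
    rw [hM.symm z (p.getVert s)] at e7
    simp only [Walk.getVert_zero, Walk.getVert_length] at e1 e2 e3 e4
    have := hM.symm y z
    have := hM.symm y w
    rcases le_total s t with h | h
    · have e := dist_getVert_le p h
      omega
    · have e := dist_getVert_le p h
      rw [hM.symm] at e
      omega

end Graph

/-! ### Shortest three-colored geodesics in a median metric -/

/-- No `3`-term arithmetic progression of the distance function `d` is rainbow. -/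
def NoRainbow {X C : Type*} (d : X → X → ℕ) (c : X → C) : Prop :=
  ∀ x y z, d x y = d y z → c x = c y ∨ c y = c z ∨ c x = c z

/-- Every ordered triple of vertices of three distinct colors spans a walk of length at least
`m`. -/
def TricolorBound {X C : Type*} (d : X → X → ℕ) (c : X → C) (m : ℕ) : Prop :=
  ∀ x y z, c x ≠ c y → c y ≠ c z → c x ≠ c z → m ≤ d x y + d y z

/-- The vertices `x` and `z` have colors `α` and `γ`, their distance is `m`, and there is a
geodesic from `x` to `z` whose first step ends in the color `β`. -/
def Extremal {X C : Type*} (d : X → X → ℕ) (c : X → C) (m : ℕ) (α β γ : C) (x z : X) : Prop :=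
  c x = α ∧ c z = γ ∧ d x z = m ∧ ∃ w, c w = β ∧ d x w = 1 ∧ d w z + 1 = m

section Median

variable {X C : Type*} {d : X → X → ℕ} {c : X → C} {m : ℕ} {α β γ : C} {x y z : X}

/-- The shortest walk through three colors can be taken to be a geodesic whose first step
changes the color. -/
theorem exists_extremal (hd : IsMedianDist d)
    (hc : ∃ x y z, c x ≠ c y ∧ c y ≠ c z ∧ c x ≠ c z) :
    ∃ m α β γ x z, α ≠ β ∧ β ≠ γ ∧ α ≠ γ ∧ TricolorBound d c m ∧ Extremal d c m α β γ x z := by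
  classical
  have hex : ∃ k, ∃ x y z, c x ≠ c y ∧ c y ≠ c z ∧ c x ≠ c z ∧ d x y + d y z = k := by
    obtain ⟨x, y, z, h1, h2, h3⟩ := hc
    exact ⟨_, x, y, z, h1, h2, h3, rfl⟩
  have hb : TricolorBound d c (Nat.find hex) := fun x y z h1 h2 h3 =>
    Nat.find_min' hex ⟨x, y, z, h1, h2, h3, rfl⟩
  obtain ⟨x, y, z, h1, h2, h3, h⟩ := Nat.find_spec hex
  generalize Nat.find hex = m at hb h
  have hxy : d x y ≠ 0 := fun h => h1 (congrArg c (hd.eq_of_zero h))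
  have hyz : d y z ≠ 0 := fun h => h2 (congrArg c (hd.eq_of_zero h))
  obtain ⟨w, hw1, hw2⟩ := hd.between (Nat.one_le_iff_ne_zero.2 hxy)
  have hwx : c w ≠ c x := by
    intro e
    have := hb w y z (e ▸ h1) h2 (e ▸ h3)
    omega
  have hwy : c w = c y := by
    by_contra e
    have := hb x w y hwx.symm e h1
    omega
  have hwz := hd.triangle w y z
  have h4 := hb x w z hwx.symm (hwy ▸ h2) h3
  have h5 := hb w x z hwx h3 (hwy ▸ h2)
  have h6 := hd.symm x w
  have h7 := hd.triangle x w z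
  -- The bounds leave `d x z = m - 1` or `d x z = m`; parity excludes the former.
  obtain ⟨k, hk⟩ := hd.parity x w z
  exact ⟨m, c x, c y, c z, x, z, h1, h2, h3, hb, rfl, rfl, by omega, w, hwy, hw1, by omega⟩

theorem Extremal.two_le (hd : IsMedianDist d) (hβγ : β ≠ γ) (h : Extremal d c m α β γ x z) :
    2 ≤ m := by
  obtain ⟨-, hz, -, w, hw, -, h2⟩ := h
  by_contra hm
  have : w = z := hd.eq_of_zero (by omega)
  exact hβγ (by rw [← hw, ← hz, this])

/-- Vertices on a geodesic after the first step have the middle color. -/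
theorem Extremal.color_of_first_step (hb : TricolorBound d c m)
    (hαβ : α ≠ β) (hβγ : β ≠ γ) (hαγ : α ≠ γ) (hx : c x = α) (hz : c z = γ) {w t : X}
    (hw : c w = β) (hxw : d x w = 1) (hwz : d w z + 1 = m) (ht : d w t + d t z = d w z)
    (htz : d t z ≠ 0) : c t = β := by
  by_contra h
  have h1 : c t = α := by
    by_contra h'
    have := hb x w t (by rw [hx, hw]; exact hαβ) (by rw [hw]; exact Ne.symm h)
      (by rw [hx]; exact Ne.symm h')
    omega
  have := hb w t z (by rw [hw]; exact Ne.symm h) (by rw [h1, hz]; exact hαγ)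
    (by rw [hw, hz]; exact hβγ)
  omega

theorem Extremal.odd (hd : IsMedianDist d) (hn : NoRainbow d c) (hb : TricolorBound d c m)
    (hαβ : α ≠ β) (hβγ : β ≠ γ) (hαγ : α ≠ γ) (h : Extremal d c m α β γ x z) : Odd m := by
  have hm := h.two_le hd hβγ
  obtain ⟨hx, hz, hxz, w, hw, hxw, hwz⟩ := h
  by_contra hodd
  obtain ⟨k, hk⟩ := Nat.not_odd_iff_even.1 hodd
  -- As `w` is one step from `x`, this `t` is the midpoint; it has color `β`, so `x, t, z` is
  -- rainbow.
  obtain ⟨t, ht1, ht2⟩ := hd.between (x := w) (y := z) (s := k - 1) (by omega)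
  have hct := Extremal.color_of_first_step hb hαβ hβγ hαγ hx hz hw hxw hwz
    (by omega) (by omega) (t := t)
  have h1 := hd.triangle x w t
  have h2 := hd.triangle x t z
  rcases hn x t z (by omega) with h | h | h
  · exact hαβ (by rw [← hx, ← hct, h])
  · exact hβγ (by rw [← hz, ← hct, h])
  · exact hαγ (by rw [← hx, ← hz, h])

/-- All inner vertices of the interval between `x` and `z` have the middle color. -/
theorem Extremal.color_between (hd : IsMedianDist d) (hn : NoRainbow d c)
    (hb : TricolorBound d c m) (hαβ : α ≠ β) (hβγ : β ≠ γ) (hαγ : α ≠ γ)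
    (h : Extremal d c m α β γ x z) {t : X} (ht : d x t + d t z = m) (hxt : d x t ≠ 0)
    (htz : d t z ≠ 0) : c t = β := by
  obtain ⟨k, hk⟩ := h.odd hd hn hb hαβ hβγ hαγ
  have hm := h.two_le hd hβγ
  obtain ⟨hx, hz, hxz, w, hw, hxw, hwz⟩ := h
  -- Either `t` lies on a geodesic from `w` to `z`, or the median `s` is a neighbor of `t` of color
  -- `β`; then `x, t, s` and `t, s, z` are both too short to carry three colors.
  have far : ∀ t, d x t + d t z = m → d x t ≠ 0 → 2 ≤ d t z → c t = β := by
    intro t ht hxt htz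
    obtain ⟨s, hs1, hs2, hs3⟩ := hd.median t w z
    have e1 := hd.triangle w x t
    have e2 := hd.symm x w
    have e3 := hd.triangle w t z
    have e4 := hd.symm t w
    have e5 := hd.symm s w
    obtain ⟨l, hl⟩ := hd.parity t w z
    by_cases hts : d t s = 0
    · obtain rfl := hd.eq_of_zero hts
      exact Extremal.color_of_first_step hb hαβ hβγ hαγ hx hz hw hxw hwz (by omega) (by omega)
    have hts : d t s = 1 := by omega
    have hcs : c s = β := Extremal.color_of_first_step hb hαβ hβγ hαγ hx hz hw hxw hwz hs3
      (by omega)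
    by_contra h'
    have hct : c t = α := by
      by_contra h''
      have := hb x t s (by rw [hx]; exact Ne.symm h'') (by rwa [hcs]) (by rw [hx, hcs]; exact hαβ)
      omega
    have := hb t s z (by rwa [hcs]) (by rwa [hcs, hz]) (by rwa [hct, hz])
    omega
  by_cases h2 : 2 ≤ d t z
  · exact far t ht hxt h2
  -- Here `d x t = m - 1 = 2 * k`: `s` is the midpoint of `x` and `t`, and `r` is the neighbor of
  -- `t` before it. The progression `x, s, t` leaves only `α` for `t`, and then `r, t, z` is too
  -- short.
  obtain ⟨s, hs1, hs2⟩ := hd.between (x := x) (y := t) (s := k) (by omega)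
  obtain ⟨r, hr1, hr2⟩ := hd.between (x := x) (y := t) (s := m - 2) (by omega)
  have e1 := hd.triangle s t z
  have e2 := hd.triangle x s z
  have e3 := hd.triangle r t z
  have e4 := hd.triangle x r z
  have hs := far s (by omega) (by omega) (by omega)
  have hr := far r (by omega) (by omega) (by omega)
  by_contra h'
  rcases hn x s t (by omega) with h | h | h
  · exact hαβ (by rw [← hx, ← hs, h])
  · exact h' (by rw [← hs, h])
  have := hb r t z (by rw [hr]; exact Ne.symm h') (by rw [← h, hx, hz]; exact hαγ)
    (by rwa [hr, hz])
  omega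

theorem Extremal.swap (hd : IsMedianDist d) (hn : NoRainbow d c)
    (hb : TricolorBound d c m) (hαβ : α ≠ β) (hβγ : β ≠ γ) (hαγ : α ≠ γ)
    (h : Extremal d c m α β γ x z) : Extremal d c m γ β α z x := by
  have hm := h.two_le hd hβγ
  obtain ⟨w, hw1, hw2⟩ := hd.between (x := z) (y := x) (s := 1) (by
    rw [hd.symm, h.2.2.1]; omega)
  have e := hd.symm z x
  have e1 := hd.symm w x
  have e2 := hd.symm z w
  have e3 := h.2.2.1
  have hw := h.color_between hd hn hb hαβ hβγ hαγ (t := w) (by omega) (by omega) (by omega)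
  exact ⟨h.2.1, h.1, by omega, w, hw, hw1, by omega⟩

/-- A vertex at distance `m` from `x` which is not opposite to `z` can replace `z`. -/
theorem Extremal.sphere_of_lt (hd : IsMedianDist d) (hn : NoRainbow d c)
    (hb : TricolorBound d c m) (hαβ : α ≠ β) (hβγ : β ≠ γ) (hαγ : α ≠ γ)
    (h : Extremal d c m α β γ x z) (hxy : d x y = m) (hyz : d y z < 2 * m) :
    Extremal d c m α β γ x y := by
  have hm := h.two_le hd hβγ
  have hx := h.1
  have hz := h.2.1
  have hxz := h.2.2.1
  obtain ⟨t, ht1, ht2, ht3⟩ := hd.median x y z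
  have e := hd.symm y t
  by_cases htz : d t z = 0
  · have hyz : y = z := hd.eq_of_zero (by omega)
    rwa [hyz]
  have hct := h.color_between hd hn hb hαβ hβγ hαγ (t := t) (by omega) (by omega) htz
  have hcy : c y = γ := by
    by_contra hy
    -- The progression around `t` leaves `β` or `γ` for `y`, the one around `x` leaves `α` or `γ`.
    rcases hn y t z (by omega) with h1 | h1 | h1
    · rcases hn y x z (by rw [hd.symm y x]; omega) with h2 | h2 | h2
      · exact hαβ (by rw [← hx, ← hct, ← h1, h2])
      · exact hαγ (by rw [← hx, ← hz, h2])
      · exact hy (by rw [h2, hz])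
    · exact hβγ (by rw [← hct, h1, hz])
    · exact hy (by rw [h1, hz])
  obtain ⟨w, hw1, hw2⟩ := hd.between (x := x) (y := t) (s := 1) (by omega)
  have e1 := hd.triangle w t z
  have e2 := hd.triangle x w z
  have e3 := hd.triangle w t y
  have e4 := hd.triangle x w y
  have hw := h.color_between hd hn hb hαβ hβγ hαγ (t := w) (by omega) (by omega) (by omega)
  exact ⟨hx, hcy, hxy, w, hw, hw1, by omega⟩

/-- The colors of an extremal pair are not close to each other near an end of it. -/
theorem Extremal.far (hb : TricolorBound d c m) (hd : IsMedianDist d) (hαβ : α ≠ β) (hβγ : β ≠ γ)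
    (hαγ : α ≠ γ) (h : Extremal d c m α β γ x z) (hy : c y = γ) : m < d x y + 2 := by
  obtain ⟨hx, hz, -, w, hw, hxw, -⟩ := h
  have := hb w x y (by rw [hw, hx]; exact hαβ.symm) (by rwa [hx, hy]) (by rwa [hw, hy])
  have := hd.symm x w
  omega

/-- A vertex of a fourth color is far from the ends of an extremal pair. -/
theorem Extremal.le_of_fourth_color (hd : IsMedianDist d) (hn : NoRainbow d c)
    (hb : TricolorBound d c m) (hαβ : α ≠ β) (hβγ : β ≠ γ) (hαγ : α ≠ γ)
    (h : Extremal d c m α β γ x z) {p : X} (hpα : c p ≠ α) (hpβ : c p ≠ β) : m ≤ d x p := by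
  by_contra hlt
  have hx := h.1
  have hxz := h.2.2.1
  have h0 : d x p ≠ 0 := fun e => hpα (by rw [← hd.eq_of_zero e, hx])
  obtain ⟨s, hs1, hs2⟩ := hd.between (x := x) (y := z) (s := d x p) (by omega)
  have hs := h.color_between hd hn hb hαβ hβγ hαγ (t := s) (by omega) (by omega) (by omega)
  rcases hn p x s (by rw [hd.symm p x, hs1]) with e | e | e
  · exact hpα (by rw [e, hx])
  · exact hαβ (by rw [← hx, ← hs, e])
  · exact hpβ (by rw [e, hs])

end Median

/-! ### Moving extremal pairs in a product of two trees -/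

/-- The distance function of a Cartesian product. -/
def prodDist {V W : Type*} (d : V → V → ℕ) (d' : W → W → ℕ) (x y : V × W) : ℕ :=
  d x.1 y.1 + d' x.2 y.2

theorem IsMedianDist.prodDist {V W : Type*} {d : V → V → ℕ} {d' : W → W → ℕ}
    (hd : IsMedianDist d) (hd' : IsMedianDist d') : IsMedianDist (prodDist d d') where
  self x := by simp [AntiVdW.prodDist, hd.self, hd'.self]
  eq_of_zero {x y} h := by
    simp only [AntiVdW.prodDist, Nat.add_eq_zero_iff] at h
    exact Prod.ext (hd.eq_of_zero h.1) (hd'.eq_of_zero h.2)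
  symm x y := by simp only [AntiVdW.prodDist, hd.symm x.1, hd'.symm x.2]
  triangle x y z := by
    have := hd.triangle x.1 y.1 z.1
    have := hd'.triangle x.2 y.2 z.2
    simp only [AntiVdW.prodDist]
    omega
  between {x y s} hs := by
    simp only [AntiVdW.prodDist] at hs ⊢
    obtain ⟨a, ha1, ha2⟩ := hd.between (min_le_right s (d x.1 y.1))
    obtain ⟨b, hb1, hb2⟩ := hd'.between (x := x.2) (y := y.2) (s := s - min s (d x.1 y.1))
      (by omega)
    exact ⟨(a, b), by simp only; omega, by simp only; omega⟩
  median x y z := by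
    simp only [AntiVdW.prodDist]
    obtain ⟨a, ha1, ha2, ha3⟩ := hd.median x.1 y.1 z.1
    obtain ⟨b, hb1, hb2, hb3⟩ := hd'.median x.2 y.2 z.2
    exact ⟨(a, b), by simp only; omega, by simp only; omega, by simp only; omega⟩

/-- If a pair realizes the eccentricities of both of its ends, then it is diametral. -/
theorem IsTreeDist.exists_lt {V : Type*} {d : V → V → ℕ} (hd : IsTreeDist d) {a b u v : V}
    (h : d u v < d a b) : (∃ w, d u w = d u v + 1) ∨ ∃ w, d v w = d u v + 1 := by
  have hge : d u v < d u a ∨ d u v < d u b ∨ d u v < d v a ∨ d u v < d v b := by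
    have := hd.fourPoint u v a b
    omega
  have step : ∀ x w, d u v < d x w → ∃ w, d x w = d u v + 1 := fun x w hw =>
    (hd.between (Nat.succ_le_of_lt hw)).imp fun _ h => h.1
  rcases hge with h | h | h | h
  · exact .inl (step _ _ h)
  · exact .inl (step _ _ h)
  · exact .inr (step _ _ h)
  · exact .inr (step _ _ h)

/-- A coloring of a product of two trees without rainbow progressions, three of its colors, and
the least length `m` of a walk through three colors. -/
structure TricolorSetting {V W C : Type*} (d : V → V → ℕ) (d' : W → W → ℕ) (c : V × W → C) (m : ℕ)
    (α β γ : C) : Prop where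
  left : IsTreeDist d
  right : IsTreeDist d'
  exists_left : ∀ u, ∃ v, d u v = 1
  exists_right : ∀ u, ∃ v, d' u v = 1
  noRainbow : NoRainbow (prodDist d d') c
  bound : TricolorBound (prodDist d d') c m
  ne₁₂ : α ≠ β
  ne₂₃ : β ≠ γ
  ne₁₃ : α ≠ γ

section Product

variable {V W C : Type*} {d : V → V → ℕ} {d' : W → W → ℕ} {c : V × W → C} {m : ℕ} {α β γ : C}
  {u u' : V} {v v' : W} {x y z : V × W}

namespace TricolorSetting

theorem dist (S : TricolorSetting d d' c m α β γ) : IsMedianDist (prodDist d d') :=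
  S.left.toIsMedianDist.prodDist S.right.toIsMedianDist

theorem reverse (S : TricolorSetting d d' c m α β γ) : TricolorSetting d d' c m γ β α :=
  { S with ne₁₂ := S.ne₂₃.symm, ne₂₃ := S.ne₁₂.symm, ne₁₃ := S.ne₁₃.symm }

theorem prodDist_swap (x y : V × W) : prodDist d' d x.swap y.swap = prodDist d d' x y :=
  Nat.add_comm _ _

theorem swapFactors (S : TricolorSetting d d' c m α β γ) :
    TricolorSetting d' d (fun x => c x.swap) m α β γ where
  left := S.right
  right := S.left
  exists_left := S.exists_right
  exists_right := S.exists_left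
  noRainbow x y z h := S.noRainbow x.swap y.swap z.swap (by simpa only [prodDist_swap] using h)
  bound x y z h1 h2 h3 := by
    have := S.bound x.swap y.swap z.swap h1 h2 h3
    simpa only [prodDist_swap] using this
  ne₁₂ := S.ne₁₂
  ne₂₃ := S.ne₂₃
  ne₁₃ := S.ne₁₃

theorem extremal_swapFactors (h : Extremal (prodDist d d') c m α β γ x z) :
    Extremal (prodDist d' d) (fun x => c x.swap) m α β γ x.swap z.swap := by
  obtain ⟨h1, h2, h3, w, h4, h5, h6⟩ := h
  refine ⟨h1, h2, by rwa [prodDist_swap], w.swap, h4, by rwa [prodDist_swap], by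
    rwa [prodDist_swap]⟩

theorem symm (S : TricolorSetting d d' c m α β γ) (h : Extremal (prodDist d d') c m α β γ x z) :
    Extremal (prodDist d d') c m γ β α z x :=
  h.swap S.dist S.noRainbow S.bound S.ne₁₂ S.ne₂₃ S.ne₁₃

theorem sphere_of_lt (S : TricolorSetting d d' c m α β γ)
    (h : Extremal (prodDist d d') c m α β γ x z) (hxy : prodDist d d' x y = m)
    (hyz : prodDist d d' y z < 2 * m) : Extremal (prodDist d d') c m α β γ x y :=
  h.sphere_of_lt S.dist S.noRainbow S.bound S.ne₁₂ S.ne₂₃ S.ne₁₃ hxy hyz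

theorem three_le (S : TricolorSetting d d' c m α β γ)
    (h : Extremal (prodDist d d') c m α β γ x z) : 3 ≤ m := by
  have h1 := h.two_le S.dist S.ne₂₃
  obtain ⟨k, hk⟩ := h.odd S.dist S.noRainbow S.bound S.ne₁₂ S.ne₂₃ S.ne₁₃
  omega

/-- Otherwise the geodesic lies in one layer. Shifting its second and its next-to-last vertex to a
neighboring layer gives vertices at distance `m` from the opposite ends, so of colors `α` and `γ`;
with the second vertex itself, of color `β`, they span a walk of length `m - 1`. -/
theorem snd_ne_zero (S : TricolorSetting d d' c m α β γ)
    (h : Extremal (prodDist d d') c m α β γ x z) : d' x.2 z.2 ≠ 0 := by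
  intro h0
  have hm := S.three_le h
  obtain ⟨u, v⟩ := x
  obtain ⟨u', v'⟩ := z
  obtain rfl : v = v' := S.right.eq_of_zero h0
  have hu : d u u' = m := by
    have := h.2.2.1
    simp only [prodDist] at this h0
    omega
  obtain ⟨v₁, hv⟩ := S.exists_right v
  obtain ⟨a, ha1, ha2⟩ := S.left.between (x := u) (y := u') (s := 1) (by omega)
  obtain ⟨b, hb1, hb2⟩ := S.left.between (x := a) (y := u') (s := m - 2) (by omega)
  have e1 := S.left.symm b u'
  have e2 := S.left.triangle u a b
  have e3 := S.left.triangle u b u'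
  have e4 := S.right.symm v v₁
  have e5 := S.left.symm u a
  have e6 := S.right.self v
  have e7 := S.right.self v₁
  have h1 := S.sphere_of_lt h (y := (b, v₁)) (by simp only [prodDist]; omega)
    (by simp only [prodDist]; omega)
  have h2 := S.reverse.sphere_of_lt (S.symm h) (y := (a, v₁))
    (by simp only [prodDist, S.left.symm u']; omega)
    (by simp only [prodDist]; omega)
  have h3 := h.color_between S.dist S.noRainbow S.bound S.ne₁₂ S.ne₂₃ S.ne₁₃ (t := (a, v))
    (by simp only [prodDist]; omega) (by simp only [prodDist]; omega)
    (by simp only [prodDist]; omega)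
  have := S.bound (a, v) (a, v₁) (b, v₁) (by rw [h3, h2.2.1]; exact S.ne₁₂.symm)
    (by rw [h2.2.1, h1.2.1]; exact S.ne₁₃) (by rw [h3, h1.2.1]; exact S.ne₂₃)
  simp only [prodDist] at this
  have e8 := S.left.self a
  omega

theorem fst_ne_zero (S : TricolorSetting d d' c m α β γ)
    (h : Extremal (prodDist d d') c m α β γ x z) : d x.1 z.1 ≠ 0 :=
  S.swapFactors.snd_ne_zero (extremal_swapFactors h)

theorem sphere_of_snd_le (S : TricolorSetting d d' c m α β γ)
    (h : Extremal (prodDist d d') c m α β γ x z) (hxy : prodDist d d' x y = m)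
    (hle : d' x.2 z.2 ≤ d' x.2 y.2) : Extremal (prodDist d d') c m α β γ x y := by
  obtain ⟨w, hw1, hw2⟩ := S.right.between hle
  have h0 := S.snd_ne_zero h
  have h1 := S.fst_ne_zero h
  have hxz := h.2.2.1
  simp only [prodDist] at hxy hxz
  have e1 := S.right.triangle w x.2 z.2
  have e2 := S.right.symm x.2 w
  have e3 := S.left.self z.1
  have e4 := S.left.triangle y.1 x.1 z.1
  have e5 := S.left.symm x.1 y.1
  have e6 := S.right.symm y.2 w
  -- The vertex `(z.1, w)` is opposite neither to `z` (same first coordinate) nor to `y` (`w` lies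
  -- on the way to `y.2`), so it links the two.
  have h2 := S.sphere_of_lt h (y := (z.1, w)) (by simp only [prodDist]; omega)
    (by simp only [prodDist]; omega)
  exact S.sphere_of_lt h2 (by simp only [prodDist]; omega) (by simp only [prodDist]; omega)

/-- Any vertex at distance `m` from `x` can replace `z` in an extremal pair. -/
theorem sphere (S : TricolorSetting d d' c m α β γ)
    (h : Extremal (prodDist d d') c m α β γ x z) (hxy : prodDist d d' x y = m) :
    Extremal (prodDist d d') c m α β γ x y := by
  rcases le_total (d' x.2 z.2) (d' x.2 y.2) with hle | hle
  · exact S.sphere_of_snd_le h hxy hle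
  · have hxz := h.2.2.1
    have h1 := extremal_swapFactors h
    have h2 : d x.1 z.1 ≤ d x.1 y.1 := by simp only [prodDist] at hxy hxz; omega
    have h3 := S.swapFactors.sphere_of_snd_le (y := y.swap) h1 (by rwa [prodDist_swap]) h2
    simpa using extremal_swapFactors h3

theorem sphere' (S : TricolorSetting d d' c m α β γ)
    (h : Extremal (prodDist d d') c m α β γ x z) (hyz : prodDist d d' y z = m) :
    Extremal (prodDist d d') c m α β γ y z :=
  S.reverse.symm (S.reverse.sphere (S.symm h) (by rwa [S.dist.symm]))

/-- There is an extremal pair which is diametral in the first factor. -/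
theorem exists_fst_eq (S : TricolorSetting d d' c m α β γ)
    (h : Extremal (prodDist d d') c m α β γ x z) (a b : V) (hab : ∀ u v, d u v ≤ d a b) :
    ∃ u u' v v', d u u' = d a b ∧ Extremal (prodDist d d') c m α β γ (u, v) (u', v') := by
  obtain ⟨k, hk⟩ : ∃ k, d x.1 z.1 + k = d a b := ⟨_, Nat.add_sub_cancel' (hab _ _)⟩
  induction k generalizing x z with
  | zero => exact ⟨x.1, z.1, x.2, z.2, hk, h⟩
  | succ k ih =>
    have h0 := S.snd_ne_zero h
    have hxz := h.2.2.1
    obtain ⟨w, hw1, hw2⟩ := S.right.between (x := x.2) (y := z.2) (s := d' x.2 z.2 - 1) (by omega)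
    obtain ⟨w', hw1', hw2'⟩ := S.right.between (x := x.2) (y := z.2) (s := 1) (by omega)
    simp only [prodDist] at hxz
    rcases S.left.exists_lt (u := x.1) (v := z.1) (a := a) (b := b) (by omega) with ⟨p, hp⟩ | ⟨p, hp⟩
    · exact ih (S.sphere h (y := (p, w)) (by simp only [prodDist]; omega)) (by simp only; omega)
    · rw [S.left.symm] at hp
      exact ih (S.sphere' h (y := (p, w')) (by simp only [prodDist]; omega)) (by simp only; omega)

/-- Descent on the distance to `q`. The pair is diametral in the first factor, so a vertex at
distance at least `m` needs second distance at least `d' v v'`; the second coordinate can thus step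
towards `q`, swapping the ends each time. -/
theorem not_fourth_color_aux (N : ℕ) {e : C} (heβ : e ≠ β) {p : V} {q : W} (hp : c (p, q) = e)
    (hu : ∀ a b, d a b ≤ d u u') (α γ : C) (S : TricolorSetting d d' c m α β γ) (hα : e ≠ α)
    (hγ : e ≠ γ) (hq : d' v q ≤ N) : ¬ Extremal (prodDist d d') c m α β γ (u, v) (u', v') := by
  induction N generalizing u u' v v' α γ with
  | zero =>
    intro h
    have h1 := h.le_of_fourth_color S.dist S.noRainbow S.bound S.ne₁₂ S.ne₂₃ S.ne₁₃ (p := (p, q))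
      (hp ▸ hα) (hp ▸ heβ)
    have h2 := h.2.2.1
    have h3 := S.snd_ne_zero h
    have h4 := hu u p
    simp only [prodDist] at h1 h2 h3
    omega
  | succ N ih =>
    intro h
    have h1 := h.le_of_fourth_color S.dist S.noRainbow S.bound S.ne₁₂ S.ne₂₃ S.ne₁₃ (p := (p, q))
      (hp ▸ hα) (hp ▸ heβ)
    have h2 := h.2.2.1
    have h3 := S.snd_ne_zero h
    have h4 := hu u p
    simp only [prodDist] at h1 h2 h3
    obtain ⟨w, hw1, hw2⟩ := S.right.between (x := v) (y := q) (s := d' v v') (by omega)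
    have h5 := S.sphere h (y := (u', w)) (by simp only [prodDist]; omega)
    exact ih (by rwa [S.left.symm u' u]) γ α S.reverse hγ hα (by omega) (S.symm h5)

/-- There is no fourth color. -/
theorem eq_color (S : TricolorSetting d d' c m α β γ)
    (h : Extremal (prodDist d d') c m α β γ x z) (a b : V) (hab : ∀ u v, d u v ≤ d a b)
    (p : V × W) : c p = α ∨ c p = β ∨ c p = γ := by
  by_contra hc
  push Not at hc
  obtain ⟨u, u', v, v', hu, h⟩ := S.exists_fst_eq h a b hab
  exact not_fourth_color_aux (p := p.1) (q := p.2) _ hc.2.1 rfl (hu ▸ hab) α γ S hc.1 hc.2.2 le_rfl h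

/-- With an even total diameter, an extremal pair which is diametral in the first factor can be
enlarged in the second factor at one of its ends. -/
theorem exists_snd_succ (S : TricolorSetting d d' c m α β γ)
    (h : Extremal (prodDist d d') c m α β γ (u, v) (u', v')) (a' b' : W)
    (hab' : ∀ u v, d' u v ≤ d' a' b') (heven : Even (d u u' + d' a' b')) :
    (∃ w, d' v w = d' v v' + 1) ∨ ∃ w, d' v' w = d' v v' + 1 := by
  refine S.right.exists_lt (a := a') (b := b') (lt_of_le_of_ne (hab' _ _) fun e => ?_)
  obtain ⟨k, hk⟩ := h.odd S.dist S.noRainbow S.bound S.ne₁₂ S.ne₂₃ S.ne₁₃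
  obtain ⟨l, hl⟩ := heven
  have := h.2.2.1
  simp only [prodDist] at this
  omega

/-- Trading the only step in the first factor for one in the second would put an extremal pair into
a single layer. -/
theorem fst_ne_one (S : TricolorSetting d d' c m α β γ)
    (h : Extremal (prodDist d d') c m α β γ (u, v) (u', v')) (a' b' : W)
    (hab' : ∀ u v, d' u v ≤ d' a' b') (heven : Even (d u u' + d' a' b')) : d u u' ≠ 1 := by
  intro h1
  have hm := h.2.2.1
  simp only [prodDist] at hm
  rcases S.exists_snd_succ h a' b' hab' heven with ⟨w, hw⟩ | ⟨w, hw⟩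
  · have e := S.left.self u
    exact S.fst_ne_zero (S.sphere h (y := (u, w)) (by simp only [prodDist]; omega)) e
  · have e := S.left.self u'
    rw [S.right.symm] at hw
    exact S.fst_ne_zero (S.sphere' h (y := (u', w)) (by simp only [prodDist]; omega)) e

/-- Via `(p, w)` of color `γ`, the vertex `(u', v)` gets color `α`, but it is only `d' v v' ≤ m - 2`
away from `(u', v')`. -/
theorem not_extremal_of_even_aux (S : TricolorSetting d d' c m α β γ)
    (h : Extremal (prodDist d d') c m α β γ (u, v) (u', v')) (hu : 2 ≤ d u u') {p : V}
    (hp : d u p + 1 = d u u') (hp' : d u' p + 1 = d u u') {w : W} (hw : d' v w = d' v v' + 1) :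
    False := by
  have hm := h.2.2.1
  simp only [prodDist] at hm
  have h1 := S.sphere h (y := (p, w)) (by simp only [prodDist]; omega)
  have h2 := S.sphere' h1 (y := (u', v)) (by simp only [prodDist]; omega)
  have h3 := h2.far S.bound S.dist S.ne₁₂ S.ne₂₃ S.ne₁₃ h.2.1
  have e := S.left.self u'
  simp only [prodDist] at h3
  omega

theorem not_extremal_of_odd_aux (S : TricolorSetting d d' c m α β γ)
    (h : Extremal (prodDist d d') c m α β γ (u, v) (u', v')) (hu : 3 ≤ d u u') {p : V}
    (hp : d u p + 1 = d u u') (hp' : d u' p = d u u') {w : W} (hw : d' v w = d' v v' + 1) :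
    False := by
  have hm := h.2.2.1
  simp only [prodDist] at hm
  have h1 := S.sphere h (y := (p, w)) (by simp only [prodDist]; omega)
  obtain ⟨q, hq1, hq2⟩ := S.right.between (x := v) (y := w) (s := 1) (by omega)
  have h2 := S.sphere' h1 (y := (u', q)) (by simp only [prodDist]; omega)
  have h3 := h2.far S.bound S.dist S.ne₁₂ S.ne₂₃ S.ne₁₃ h.2.1
  have e := S.left.self u'
  have e1 := S.right.triangle q v v'
  have e2 := S.right.symm v q
  simp only [prodDist] at h3
  omega

end TricolorSetting

/-! ### Weak factors exclude three colors -/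

/-- The distance function has diameter one, or a diametral pair with a third vertex at almost
diametral distance from both, or for each diametral pair a third vertex at diametral distance from
the second and almost diametral distance from the first end. -/
def IsWeakDist (d : V → V → ℕ) (n : ℕ) : Prop :=
  n = 1 ∨ (2 ≤ n ∧ ∃ u u' p, d u u' = n ∧ d u p + 1 = n ∧ d u' p + 1 = n) ∨
    (3 ≤ n ∧ ∀ u u', d u u' = n → ∃ p, d u p + 1 = n ∧ d u' p = n)

namespace TricolorSetting

theorem not_extremal_of_isWeakDist (S : TricolorSetting d d' c m α β γ)
    (h : Extremal (prodDist d d') c m α β γ x z) (a b : V) (hab : ∀ u v, d u v ≤ d a b)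
    (a' b' : W) (hab' : ∀ u v, d' u v ≤ d' a' b') (heven : Even (d a b + d' a' b'))
    (hweak : IsWeakDist d (d a b)) : False := by
  obtain ⟨u, u', v, v', hu, h⟩ := S.exists_fst_eq h a b hab
  have hm := h.2.2.1
  simp only [prodDist] at hm
  rcases hweak with h1 | ⟨h2, s, t, p, hst, hs, ht⟩ | ⟨h3, hp⟩
  · exact S.fst_ne_one h a' b' hab' (hu ▸ heven) (hu.trans h1)
  · have key : ∀ s t, d s t = d a b → d s p + 1 = d a b → d t p + 1 = d a b →
        d u t + d u' s = 2 * d a b → False := by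
      intro s t hst hs ht hsum
      have e1 := hab u t
      have e2 := hab u' s
      have e3 := S.left.symm u' s
      have k1 := S.sphere h (y := (t, v')) (by simp only [prodDist]; omega)
      have k2 := S.sphere' k1 (y := (s, v)) (by simp only [prodDist]; omega)
      rcases S.exists_snd_succ k2 a' b' hab' (hst ▸ heven) with ⟨w, hw⟩ | ⟨w, hw⟩
      · exact S.not_extremal_of_even_aux k2 (by omega) (p := p) (by omega) (by omega) hw
      · have e4 := S.left.symm s t
        have e5 := S.right.symm v v'
        exact S.reverse.not_extremal_of_even_aux (S.symm k2) (by omega) (p := p) (by omega)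
          (by omega) (w := w) (by omega)
    -- One of the two matchings of `u, u'` with `s, t` consists of diametral pairs, so the extremal
    -- pair can be moved to lie over `s, t`.
    have e := S.left.fourPoint u u' s t
    have e1 := S.left.symm s t
    rcases le_max_iff.1 e with e | e
    · have := hab u s
      have := hab u' t
      exact key t s (by omega) ht hs (by omega)
    · have := hab u t
      have := hab u' s
      exact key s t hst hs ht (by omega)
  · rcases S.exists_snd_succ h a' b' hab' (hu ▸ heven) with ⟨w, hw⟩ | ⟨w, hw⟩
    · obtain ⟨p, hp1, hp2⟩ := hp u u' hu
      exact S.not_extremal_of_odd_aux h (by omega) (p := p) (by omega) (by omega) hw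
    · have e4 := S.left.symm u u'
      have e5 := S.right.symm v v'
      obtain ⟨p, hp1, hp2⟩ := hp u' u (by omega)
      exact S.reverse.not_extremal_of_odd_aux (S.symm h) (by omega) (p := p) (by omega)
          (by omega) (w := w) (by omega)

end TricolorSetting

/-- A coloring of a product of two trees without rainbow progressions has at most three colors. -/
theorem not_noRainbow_of_fourColors (hd : IsTreeDist d) (hd' : IsTreeDist d')
    (hV : ∀ u, ∃ v, d u v = 1) (hW : ∀ u, ∃ v, d' u v = 1) {a b : V} (hab : ∀ u v, d u v ≤ d a b)
    {c : V × W → Fin 4} (hc : Function.Surjective c) : ¬ NoRainbow (prodDist d d') c := by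
  intro hn
  have h3 : ∃ x y z, c x ≠ c y ∧ c y ≠ c z ∧ c x ≠ c z := by
    obtain ⟨x, hx⟩ := hc 0
    obtain ⟨y, hy⟩ := hc 1
    obtain ⟨z, hz⟩ := hc 2
    exact ⟨x, y, z, by simp [hx, hy], by simp [hy, hz], by simp [hx, hz]⟩
  obtain ⟨m, α, β, γ, x, z, h1, h2, h3, hb, h⟩ :=
    exists_extremal (hd.toIsMedianDist.prodDist hd'.toIsMedianDist) h3
  have S : TricolorSetting d d' c m α β γ := ⟨hd, hd', hV, hW, hn, hb, h1, h2, h3⟩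
  obtain ⟨e, he⟩ : ∃ e : Fin 4, e ≠ α ∧ e ≠ β ∧ e ≠ γ := by
    clear * -
    revert α β γ
    decide
  obtain ⟨p, rfl⟩ := hc e
  rcases S.eq_color h a b hab p with k | k | k
  · exact he.1 k
  · exact he.2.1 k
  · exact he.2.2 k

theorem not_noRainbow_of_isWeakDist (hd : IsTreeDist d) (hd' : IsTreeDist d')
    (hV : ∀ u, ∃ v, d u v = 1) (hW : ∀ u, ∃ v, d' u v = 1) {a b : V} (hab : ∀ u v, d u v ≤ d a b)
    {a' b' : W} (hab' : ∀ u v, d' u v ≤ d' a' b') (heven : Even (d a b + d' a' b'))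
    (hweak : IsWeakDist d (d a b) ∨ IsWeakDist d' (d' a' b'))
    {c : V × W → Fin 3} (hc : Function.Surjective c) : ¬ NoRainbow (prodDist d d') c := by
  intro hn
  have h3 : ∃ x y z, c x ≠ c y ∧ c y ≠ c z ∧ c x ≠ c z := by
    obtain ⟨x, hx⟩ := hc 0
    obtain ⟨y, hy⟩ := hc 1
    obtain ⟨z, hz⟩ := hc 2
    exact ⟨x, y, z, by simp [hx, hy], by simp [hy, hz], by simp [hx, hz]⟩
  obtain ⟨m, α, β, γ, x, z, h1, h2, h3, hb, h⟩ :=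
    exists_extremal (hd.toIsMedianDist.prodDist hd'.toIsMedianDist) h3
  have S : TricolorSetting d d' c m α β γ := ⟨hd, hd', hV, hW, hn, hb, h1, h2, h3⟩
  rcases hweak with hw | hw
  · exact S.not_extremal_of_isWeakDist h a b hab a' b' hab' heven hw
  · exact S.swapFactors.not_extremal_of_isWeakDist (TricolorSetting.extremal_swapFactors h)
      a' b' hab' a b hab (by rwa [Nat.add_comm]) hw

/-- The pair `u, u'` is diametral and no third vertex is at almost diametral distance from `u` and
at (almost) diametral distance from `u'`, or at diametral distance from both. -/
structure IsStrongPair (d : V → V → ℕ) (n : ℕ) (u u' : V) : Prop where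
  dist_eq : d u u' = n
  dist_le : ∀ a b, d a b ≤ n
  not₁ : ∀ p, d u p = n → d u' p = n → False
  not₂ : ∀ p, d u p + 1 = n → d u' p = n → False
  not₃ : ∀ p, d u p + 1 = n → d u' p + 1 = n → False

namespace IsStrongPair

variable {n : ℕ} {p q : V}

/-- A vertex `p` opposite to `u'` is not opposite to `u`, so in the four-point condition the
matching through `d p u` is not the maximum: `p` and `u` have the same opposite vertices. -/
theorem far_iff (hd : IsTreeDist d) (h : IsStrongPair d n u u') (hp : d p u' = n) :
    d p q = n ↔ d u q = n := by
  have h0 := h.dist_eq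
  have hle := h.dist_le
  have h1 : d p u ≠ n := fun e => h.not₁ p (by rw [hd.symm, e]) (by rw [hd.symm, hp])
  have e1 := hd.fourPoint p q u u'
  have e2 := hd.fourPoint p u' u q
  have := hle p u
  have := hle p q
  have := hle u q
  have := hle q u'
  have := hd.symm q u
  have := hd.symm u' q
  have := hd.symm u' u
  omega

theorem almost_far_iff (hd : IsTreeDist d) (h : IsStrongPair d n u u') (hp : d p u' = n) :
    d p q + 1 = n ↔ d u q + 1 = n := by
  have h0 := h.dist_eq
  have hle := h.dist_le
  have h1 : d p u ≠ n := fun e => h.not₁ p (by rw [hd.symm, e]) (by rw [hd.symm, hp])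
  have h2 : d p u + 1 ≠ n := fun e => h.not₂ p (by rw [hd.symm, e]) (by rw [hd.symm, hp])
  have e1 := hd.fourPoint p q u u'
  have e2 := hd.fourPoint p u' u q
  obtain ⟨k, hk⟩ := hd.parity p u u'
  obtain ⟨l, hl⟩ := hd.parity p u q
  have := hle p u
  have := hle p q
  have := hle u q
  have := hle q u'
  have := hd.symm q u
  have := hd.symm u' q
  have := hd.symm u' u
  omega

theorem far_iff' (hd : IsTreeDist d) (h : IsStrongPair d n u u') (hq : d u q = n) :
    d p q = n ↔ d p u' = n := by
  refine ⟨fun hpq => ?_, fun hp => (h.far_iff hd hp).2 hq⟩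
  have h0 := h.dist_eq
  have hle := h.dist_le
  have h1 : d u' q ≠ n := fun e => h.not₁ q hq e
  have e1 := hd.fourPoint p q u u'
  have := hle p u
  have := hle p u'
  have := hle q u'
  have := hd.symm q u
  have := hd.symm u' q
  omega

/-- A vertex opposite to neither end of a diametral pair is opposite to nothing, by the four-point
condition. -/
theorem almost_far_lt (hd : IsTreeDist d) (h : IsStrongPair d n u u') (hq : d u q + 1 = n) :
    d p q < n := by
  have h0 := h.dist_eq
  have hle := h.dist_le
  have h1 : d u' q ≠ n := fun e => h.not₂ q hq e
  have e1 := hd.fourPoint p q u u'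
  have := hle p u
  have := hle p u'
  have := hle p q
  have := hle q u'
  have := hd.symm q u
  have := hd.symm u' q
  omega

theorem almost_far_iff' (hd : IsTreeDist d) (h : IsStrongPair d n u u') (hq : d u q + 1 = n) :
    d p q + 1 = n ↔ d p u' = n := by
  refine ⟨fun hpq => ?_, fun hp => (h.almost_far_iff hd hp).2 hq⟩
  have h0 := h.dist_eq
  have hle := h.dist_le
  have h1 : d u' q ≠ n := fun e => h.not₂ q hq e
  have h2 : d u' q + 1 ≠ n := fun e => h.not₃ q hq e
  have e1 := hd.fourPoint p q u u'
  have := hle p u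
  have := hle p u'
  have := hle q u'
  have := hd.symm q u
  have := hd.symm u' q
  omega

theorem two_le (hd : IsTreeDist d) (h : IsStrongPair d n u u') : 2 ≤ n := by
  by_contra hn
  have h0 := h.dist_eq
  have e := hd.self u
  have e' := hd.symm u u'
  by_cases hn0 : n = 0
  · exact h.not₁ u (by omega) (by omega)
  · exact h.not₂ u (by omega) (by omega)

end IsStrongPair

/-- The product of two trees with strong pairs has a coloring with three colors and without
rainbow progressions. -/
theorem exists_noRainbow_of_isStrongPair (hd : IsTreeDist d) (hd' : IsTreeDist d') {n n' : ℕ}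
    {u u' : V} {v v' : W} (h : IsStrongPair d n u u') (h' : IsStrongPair d' n' v v')
    (heven : Even (n + n')) :
    ∃ c : V × W → Fin 3, Function.Surjective c ∧ NoRainbow (prodDist d d') c := by
  classical
  have hn := h.two_le hd
  have hn' := h'.two_le hd'
  let R : V × W → Prop := fun x => d x.1 u' = n ∧ d' x.2 v' = n'
  let B : V × W → Prop := fun x =>
    (d u x.1 = n ∧ d' v x.2 + 1 = n') ∨ (d u x.1 + 1 = n ∧ d' v x.2 = n')
  have hD := hd.toIsMedianDist.prodDist hd'.toIsMedianDist
  have red : ∀ x y, R x → (prodDist d d' x y + 1 = n + n' ↔ B y) := by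
    rintro x y ⟨hx, hx'⟩
    have e1 := h.far_iff hd hx (q := y.1)
    have e2 := h'.far_iff hd' hx' (q := y.2)
    have e3 := h.almost_far_iff hd hx (q := y.1)
    have e4 := h'.almost_far_iff hd' hx' (q := y.2)
    have e5 := h.dist_le x.1 y.1
    have e6 := h'.dist_le x.2 y.2
    simp only [prodDist, B, ← e1, ← e2, ← e3, ← e4]
    omega
  have blue : ∀ x y, B y → (prodDist d d' x y + 1 = n + n' ↔ R x) := by
    intro x y hy
    refine ⟨fun hxy => ?_, fun hx => (red x y hx).2 hy⟩
    simp only [prodDist] at hxy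
    have e5 := h.dist_le x.1 y.1
    have e6 := h'.dist_le x.2 y.2
    rcases hy with ⟨hy1, hy2⟩ | ⟨hy1, hy2⟩
    · have e1 := h.far_iff' hd hy1 (p := x.1)
      have e2 := h'.almost_far_iff' hd' hy2 (p := x.2)
      have e3 := h'.almost_far_lt hd' hy2 (p := x.2)
      simp only [R, ← e1, ← e2]
      omega
    · have e1 := h.almost_far_iff' hd hy1 (p := x.1)
      have e2 := h'.far_iff' hd' hy2 (p := x.2)
      have e3 := h.almost_far_lt hd hy1 (p := x.1)
      simp only [R, ← e1, ← e2]
      omega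
  have disj : ∀ x, R x → ¬ B x := by
    intro x hx hx'
    have := (red x x hx).2 hx'
    rw [hD.self] at this
    omega
  let c : V × W → Fin 3 := fun x => if R x then 0 else if B x then 1 else 2
  have c0 : ∀ x, c x = 0 → R x := by
    intro x hx
    by_contra hr
    by_cases hB : B x <;> simp [c, hr, hB] at hx
  have c1 : ∀ x, c x = 1 → B x := by
    intro x hx
    by_contra hB
    by_cases hr : R x <;> simp [c, hr, hB] at hx
  have cR : ∀ x, R x → c x = 0 := fun x hx => by simp [c, hx]
  have cB : ∀ x, B x → c x = 1 := fun x hx => by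
    have : ¬ R x := fun hr => disj x hr hx
    simp [c, hx, this]
  have hRu : R (u, v) := ⟨h.dist_eq, h'.dist_eq⟩
  refine ⟨c, ?_, ?_⟩
  · intro i
    fin_cases i
    · exact ⟨_, cR _ hRu⟩
    · obtain ⟨w, hw, -⟩ := hd'.between (x := v) (y := v') (s := n' - 1) (by
        rw [h'.dist_eq]; omega)
      exact ⟨(u', w), cB _ (.inl ⟨h.dist_eq, by simp only; omega⟩)⟩
    · refine ⟨(u', v'), ?_⟩
      have h1 : ¬ R (u', v') := by
        rintro ⟨e, -⟩
        have := hd.self u'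
        simp only at e
        omega
      have h2 : ¬ B (u', v') := by
        have := h.dist_eq
        have := h'.dist_eq
        simp only [B]
        omega
      simp [c, h1, h2]
  -- Excludes a white middle vertex: equal legs make the distance of the ends even, but from red to
  -- blue it is the odd number `n + n' - 1`.
  · have odd : ∀ x y z, R x → B z → prodDist d d' x y ≠ prodDist d d' y z := by
      intro x y z hx hz e
      have h1 := (red x z hx).2 hz
      obtain ⟨k, hk⟩ := hD.parity x y z
      obtain ⟨l, hl⟩ := heven
      omega
    intro x y z hxyz
    by_contra hne
    push Not at hne
    obtain ⟨n1, n2, n3⟩ := hne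
    have mid : ∀ x y z, prodDist d d' x y = prodDist d d' y z → c y = 0 → c x = 1 → c z = 1 := by
      intro x y z e hy hx
      have h1 := (red y x (c0 y hy)).2 (c1 x hx)
      exact cB _ ((red y z (c0 y hy)).1 (by rw [← e, hD.symm x y, h1]))
    have mid' : ∀ x y z, prodDist d d' x y = prodDist d d' y z → c y = 1 → c x = 0 → c z = 0 := by
      intro x y z e hy hx
      have h1 := (blue x y (c1 y hy)).2 (c0 x hx)
      exact cR _ ((blue z y (c1 y hy)).1 (by rw [hD.symm z y, ← e, h1]))
    have hzyx : prodDist d d' z y = prodDist d d' y x := by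
      rw [hD.symm z y, ← hxyz, hD.symm x y]
    have cases3 : c y = 0 ∨ c y = 1 ∨ (c x = 0 ∧ c z = 1) ∨ (c x = 1 ∧ c z = 0) := by
      generalize c x = i at *
      generalize c y = j at *
      generalize c z = k at *
      clear * - n1 n2 n3
      revert i j k
      decide
    rcases cases3 with hy | hy | ⟨hx, hz⟩ | ⟨hx, hz⟩
    · have : c x = 1 ∨ c z = 1 := by
        generalize c x = i at *
        generalize c y = j at *
        generalize c z = k at *
        clear * - n1 n2 n3 hy
        revert i j k
        decide
      rcases this with hx | hz
      · exact n3 (hx.trans (mid x y z hxyz hy hx).symm)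
      · exact n3 ((mid z y x hzyx hy hz).trans hz.symm)
    · have : c x = 0 ∨ c z = 0 := by
        generalize c x = i at *
        generalize c y = j at *
        generalize c z = k at *
        clear * - n1 n2 n3 hy
        revert i j k
        decide
      rcases this with hx | hz
      · exact n3 (hx.trans (mid' x y z hxyz hy hx).symm)
      · exact n3 ((mid' z y x hzyx hy hz).trans hz.symm)
    · exact odd x y z (c0 x hx) (c1 z hz) hxyz
    · exact odd z y x (c0 z hz) (c1 x hx) hzyx

end Product

/-! ### From graphs to metrics: diameters, products, progressions -/

open SimpleGraph

section Graph

variable {V W : Type*} {G : SimpleGraph V}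

theorem isPeripheral_three_iff : IsPeripheral G 3 ↔ ∃ x y z, x ≠ y ∧ x ≠ z ∧ y ≠ z ∧
    G.dist x y = G.diam ∧ G.dist x z = G.diam ∧ G.dist y z = G.diam := by
  constructor
  · rintro ⟨f, hf, h⟩
    exact ⟨f 0, f 1, f 2, hf.ne (by decide), hf.ne (by decide), hf.ne (by decide),
      h _ _ (by decide), h _ _ (by decide), h _ _ (by decide)⟩
  · rintro ⟨x, y, z, hxy, hxz, hyz, h1, h2, h3⟩
    refine ⟨![x, y, z], ?_, ?_⟩
    · intro i j hij
      fin_cases i <;> fin_cases j <;> simp_all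
    · intro i j hij
      fin_cases i <;> fin_cases j <;> simp_all [G.dist_comm]

theorem dist_le_diam_of_connected [Finite V] (hG : G.Connected) (x y : V) :
    G.dist x y ≤ G.diam := by
  have := hG.nonempty
  exact dist_le_diam (connected_iff_ediam_ne_top.1 hG)

theorem diam_eq_of_forall_le [Finite V] (hG : G.Connected) {x y : V} {k : ℕ}
    (hxy : G.dist x y = k) (h : ∀ x y, G.dist x y ≤ k) : G.diam = k := by
  have := hG.nonempty
  obtain ⟨a, b, hab⟩ := G.exists_dist_eq_diam
  have h1 := h a b
  have h2 := dist_le_diam_of_connected hG x y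
  omega

theorem isPeripheralVertex_iff [Finite V] (hG : G.Connected) (v : V) :
    IsPeripheralVertex G v ↔ ∃ w, G.dist v w = G.diam := by
  have := hG.nonempty
  have htop := connected_iff_ediam_ne_top.1 hG
  have hcoe : (G.diam : ℕ∞) = G.ediam := ENat.natCast_toNat htop
  unfold IsPeripheralVertex
  constructor
  · intro h
    obtain ⟨w, hw⟩ := G.exists_edist_eq_eccent_of_finite v
    refine ⟨w, ?_⟩
    rw [h, ← hcoe, ← (hG v w).coe_dist_eq_edist] at hw
    exact_mod_cast hw
  · rintro ⟨w, hw⟩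
    refine le_antisymm eccent_le_ediam ?_
    rw [← hcoe, ← hw, (hG v w).coe_dist_eq_edist]
    exact edist_le_eccent

theorem exists_dist_eq_one [Nontrivial V] (hG : G.IsTree) (u : V) : ∃ v, G.dist u v = 1 := by
  obtain ⟨w, hw⟩ := exists_ne u
  have h := hG.connected.pos_dist_of_ne hw.symm
  exact ((IsMedianDist.dist_of_isTree hG).between (s := 1) h).imp fun _ h => h.1

theorem diam_pos [Finite V] [Nontrivial V] (hG : G.Connected) : 0 < G.diam := by
  obtain ⟨x, y, hxy⟩ := exists_pair_ne V
  exact (hG.pos_dist_of_ne hxy).trans_le (dist_le_diam_of_connected hG x y)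

/-- A function which grows by at most one along edges grows by at most the length of a walk. -/
theorem le_add_length {g : V → ℕ} (hg : ∀ x y, G.Adj x y → g y ≤ g x + 1) {x y : V}
    (p : G.Walk x y) : g y ≤ g x + p.length := by
  induction p with
  | nil => simp
  | cons h p ih =>
    have := hg _ _ h
    rw [Walk.length_cons]
    omega

section Product

variable {H : SimpleGraph W}

theorem dist_boxProd (hG : G.Connected) (hH : H.Connected) (x y : V × W) :
    (G □ H).dist x y = prodDist G.dist H.dist x y := by
  have h := edist_boxProd (G := G) (H := H) x y
  rw [← (hG x.1 y.1).coe_dist_eq_edist, ← (hH x.2 y.2).coe_dist_eq_edist,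
    ← ((hG.boxProd hH) x y).coe_dist_eq_edist] at h
  exact_mod_cast h

theorem diam_boxProd [Finite V] [Finite W] (hG : G.Connected) (hH : H.Connected) :
    (G □ H).diam = G.diam + H.diam := by
  have := hG.nonempty
  have := hH.nonempty
  obtain ⟨a, b, hab⟩ := G.exists_dist_eq_diam
  obtain ⟨a', b', hab'⟩ := H.exists_dist_eq_diam
  refine diam_eq_of_forall_le (hG.boxProd hH) (x := (a, a')) (y := (b, b')) ?_ ?_
  · rw [dist_boxProd hG hH, prodDist, hab, hab']
  · intro x y
    rw [dist_boxProd hG hH]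
    exact Nat.add_le_add (dist_le_diam_of_connected hG _ _) (dist_le_diam_of_connected hH _ _)

end Product

theorem not_hasRainbowAP_iff {C : Type*} (hG : G.Connected) (c : V → C) :
    ¬ HasRainbowAP G 3 c ↔ NoRainbow G.dist c := by
  have he : ∀ x y, G.edist x y = (G.dist x y : ℕ∞) := fun x y => ((hG x y).coe_dist_eq_edist).symm
  constructor
  · intro h x y z hxyz
    by_contra hne
    push Not at hne
    obtain ⟨h1, h2, h3⟩ := hne
    refine h ⟨![x, y, z], ⟨G.dist x y, ?_⟩, ?_⟩
    · intro i j hij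
      rw [he]
      fin_cases i <;> fin_cases j <;> simp_all
    · intro i j hij
      fin_cases i <;> fin_cases j <;> simp_all
  · rintro h ⟨v, ⟨k, hk⟩, hinj⟩
    have h01 := hk 0 1 rfl
    have h12 := hk 1 2 rfl
    rw [← h12, he, he] at h01
    rcases h (v 0) (v 1) (v 2) (by exact_mod_cast h01) with e | e | e
    · exact absurd (hinj e) (by decide)
    · exact absurd (hinj e) (by decide)
    · exact absurd (hinj e) (by decide)

theorem three_le_aw [Nontrivial V] {G : SimpleGraph V} {r : ℕ} (hr : 1 ≤ r)
    (h : ∀ c : V → Fin r, Function.Surjective c → HasRainbowAP G 3 c) : 3 ≤ r := by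
  classical
  by_contra hlt
  have hno : ∀ c : V → Fin r, ¬ HasRainbowAP G 3 c := by
    rintro c ⟨v, -, hinj⟩
    have := Fintype.card_le_of_injective _ hinj
    simp only [Fintype.card_fin] at this
    omega
  obtain ⟨x, y, hxy⟩ := exists_pair_ne V
  obtain rfl | rfl : r = 1 ∨ r = 2 := by omega
  · exact hno _ (h (fun _ => 0) fun i => ⟨x, Subsingleton.elim _ _⟩)
  · refine hno _ (h (fun z => if z = x then 0 else 1) fun i => ?_)
    fin_cases i
    · exact ⟨x, by simp⟩
    · exact ⟨y, by simp [hxy.symm]⟩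

theorem aw_eq_three [Nontrivial V]
    (h : ∀ c : V → Fin 3, Function.Surjective c → HasRainbowAP G 3 c) : aw G 3 = 3 :=
  le_antisymm (Nat.sInf_le ⟨by norm_num, h⟩)
    (le_csInf ⟨3, by norm_num, h⟩ fun _ hr => three_le_aw hr.1 hr.2)

theorem aw_eq_four [Nontrivial V]
    (h : ∀ c : V → Fin 4, Function.Surjective c → HasRainbowAP G 3 c)
    (h' : ∃ c : V → Fin 3, Function.Surjective c ∧ ¬ HasRainbowAP G 3 c) : aw G 3 = 4 := by
  refine le_antisymm (Nat.sInf_le ⟨by norm_num, h⟩) (le_csInf ⟨4, by norm_num, h⟩ fun r hr => ?_)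
  refine lt_of_le_of_ne (three_le_aw hr.1 hr.2) ?_
  rintro rfl
  obtain ⟨c, hc, hn⟩ := h'
  exact hn (hr.2 c hc)

/-! ### Distances after adding a leaf -/

section AddLeaf

/-- The inclusion of a graph into the graph with an additional leaf. -/
def addLeafHom (T : SimpleGraph V) (u : V) : T →g addLeaf T u := ⟨some, fun h => h⟩

variable {T : SimpleGraph V}

theorem addLeaf_connected (hT : T.Connected) (u : V) : (addLeaf T u).Connected := by
  have key : ∀ a : Option V, (addLeaf T u).Reachable (some u) a := by
    rintro (_ | a)
    · exact Adj.reachable (G := addLeaf T u) (show u = u from rfl)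
    · exact (hT u a).map (addLeafHom T u)
  exact (connected_iff_exists_forall_reachable _).2 ⟨some u, key⟩

theorem dist_addLeaf (hT : T.Connected) (u a : V) (y : Option V) :
    (addLeaf T u).dist (some a) y = y.elim (T.dist a u + 1) (T.dist a) := by
  have hC := addLeaf_connected hT u
  have hsome : ∀ b, (addLeaf T u).dist (some a) (some b) ≤ T.dist a b := by
    intro b
    obtain ⟨p, hp⟩ := hT.exists_walk_length_eq_dist a b
    rw [← hp, ← Walk.length_map (addLeafHom T u) p]
    exact dist_le _
  refine le_antisymm ?_ ?_
  · rcases y with _ | b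
    · have h1 : (addLeaf T u).dist (some u) none = 1 :=
        dist_eq_one_iff_adj.2 (show u = u from rfl)
      have h2 := hC.dist_triangle (u := some a) (v := some u) (w := none)
      have h3 := hsome u
      simp only [Option.elim]
      omega
    · exact hsome b
  · obtain ⟨p, hp⟩ := hC.exists_walk_length_eq_dist (some a) y
    -- The function claimed to be the distance from `a` grows by at most one along each edge, which
    -- gives the lower bound.
    have hg := le_add_length (G := addLeaf T u)
      (g := fun y => y.elim (T.dist a u + 1) (T.dist a)) (by
        rintro (_ | x) (_ | y) h
        · exact h.elim
        · obtain rfl : y = u := h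
          simp only [Option.elim]; omega
        · obtain rfl : x = u := h
          simp only [Option.elim]; omega
        · have h1 : T.dist x y = 1 := dist_eq_one_iff_adj.2 h
          have := hT.dist_triangle (u := a) (v := x) (w := y)
          simp only [Option.elim]; omega) p
    have h0 : T.dist a a = 0 := dist_self
    change y.elim (T.dist a u + 1) (T.dist a) ≤ T.dist a a + p.length at hg
    omega

end AddLeaf

/-! ### Distances after removing the far vertices -/

section RemoveFar

variable {T : SimpleGraph V}

theorem dist_induce_of_convex (hT : T.Connected) {s : Set V}
    (hs : ∀ x ∈ s, ∀ y ∈ s, ∀ z, T.dist x z + T.dist z y = T.dist x y → z ∈ s) (x y : s) :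
    (T.induce s).Reachable x y ∧ (T.induce s).dist x y = T.dist x y := by
  classical
  obtain ⟨p, hp⟩ := hT.exists_walk_length_eq_dist (x : V) (y : V)
  have hmem : ∀ z ∈ p.support, z ∈ s := by
    intro z hz
    refine hs x x.2 y y.2 z ?_
    have h1 := dist_le (p.takeUntil z hz)
    have h2 := dist_le (p.dropUntil z hz)
    have h3 := congrArg Walk.length (p.take_spec hz)
    have h4 := hT.dist_triangle (u := (x : V)) (v := z) (w := y)
    rw [Walk.length_append] at h3
    omega
  let q : (T.induce s).Walk x y := p.induce s hmem
  have hql : q.length = T.dist x y :=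
    (Walk.length_map _ _).symm.trans ((congrArg Walk.length (p.map_induce hmem)).trans hp)
  refine ⟨q.reachable, le_antisymm (hql ▸ dist_le q) ?_⟩
  obtain ⟨r, hr⟩ := q.reachable.exists_walk_length_eq_dist
  rw [← hr, ← Walk.length_map (Embedding.induce s).toHom r]
  exact dist_le _

variable [Finite V]

/-- Distances survive because the remaining set is convex: by the four-point condition, a vertex
between `x` and `y` is no farther from `v` than the farther of the two. -/
theorem removeFar_spec (hT : T.IsTree) (v : V) (x y : {w : V | T.dist v w ≠ T.diam}) :
    (removeFar T v).Reachable x y ∧ (removeFar T v).dist x y = T.dist x y := by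
  refine dist_induce_of_convex hT.connected ?_ x y
  intro x hx y hy z hz hvz
  have h1 := (IsTreeDist.dist_of_isTree hT).fourPoint v z x y
  have h2 := dist_le_diam_of_connected hT.connected v x
  have h3 := dist_le_diam_of_connected hT.connected v y
  have h4 := T.dist_comm (u := x) (v := z)
  simp only [Set.mem_ofPred_eq] at hx hy
  omega

theorem removeFar_diam (hT : T.IsTree) {u u' : V} (h : T.dist u u' = T.diam) (hpos : 0 < T.diam) :
    (removeFar T u).diam + 1 = T.diam := by
  have hM := IsTreeDist.dist_of_isTree hT
  have hle := dist_le_diam_of_connected hT.connected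
  obtain ⟨w, hw1, hw2⟩ := hM.between (x := u) (y := u') (s := T.diam - 1) (by omega)
  have hu : T.dist u u ≠ T.diam := by rw [dist_self]; omega
  have hw : T.dist u w ≠ T.diam := by omega
  have hC : (removeFar T u).Connected :=
    (connected_iff_exists_forall_reachable _).2 ⟨⟨u, hu⟩, fun y => (removeFar_spec hT u _ y).1⟩
  have := diam_eq_of_forall_le hC (x := ⟨u, hu⟩) (y := ⟨w, hw⟩) (k := T.diam - 1)
    (by rw [(removeFar_spec hT u _ _).2, hw1]) (by
      rintro ⟨x, hx⟩ ⟨y, hy⟩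
      rw [(removeFar_spec hT u _ _).2]
      simp only [Set.mem_ofPred_eq] at hx hy ⊢
      have h1 := hM.fourPoint u u' x y
      have := hle u x
      have := hle u y
      have := hle u' x
      have := hle u' y
      omega)
  omega

end RemoveFar

/-! ### Weak and strong trees in metric terms -/

section Peripheral

variable [Finite V] [Nontrivial V] {T : SimpleGraph V}

theorem isP2_iff_diam_eq_one (hT : T.IsTree) : IsP2 T ↔ T.diam = 1 := by
  have hP : pathGraph 2 = ⊤ := pathGraph_two_eq_top
  rw [diam_eq_one]
  constructor
  · rintro ⟨e⟩
    ext a b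
    have hadj : ∀ i j, (pathGraph 2).Adj i j ↔ i ≠ j := fun i j => by rw [hP]; rfl
    rw [← e.map_adj_iff, hadj]
    simp
  · intro h
    have hcard : Nat.card V = 2 := by
      obtain ⟨a, b, hab⟩ := exists_pair_ne V
      refine Nat.card_eq_two_iff.2 ⟨a, b, hab, Set.eq_univ_of_forall fun x => ?_⟩
      by_contra hx
      simp only [Set.mem_insert_iff, Set.mem_singleton_iff, not_or] at hx
      have hadj : ∀ x y : V, x ≠ y → T.dist x y = 1 := fun x y hxy =>
        dist_eq_one_iff_adj.2 (by rw [h]; exact hxy)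
      obtain ⟨k, hk⟩ := (IsMedianDist.dist_of_isTree hT).parity a b x
      rw [hadj a b hab, hadj a x (Ne.symm hx.1), hadj b x (Ne.symm hx.2)] at hk
      omega
    rw [IsP2, hP, h]
    exact ⟨⟨Finite.equivFinOfCardEq hcard, by simp⟩⟩

theorem IsWeaklyNonThreePeripheral.isWeakDist (hT : T.IsTree) (h : IsWeaklyNonThreePeripheral T) :
    IsWeakDist T.dist T.diam := by
  have hM := IsTreeDist.dist_of_isTree hT
  have hle := dist_le_diam_of_connected hT.connected
  have hpos := diam_pos hT.connected
  obtain ⟨a, b, hab⟩ := T.exists_dist_eq_diam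
  obtain ⟨h0, hodd, heven⟩ := h
  rw [isPeripheral_three_iff] at h0
  rcases Nat.even_or_odd T.diam with hn | hn
  · obtain ⟨v, hv⟩ := heven hn
    obtain ⟨k, hk⟩ := hn
    obtain ⟨x, y, z, hxy, hxz, hyz, h1, h2, h3⟩ := isPeripheral_three_iff.1 hv
    -- Three old vertices at this distance would make `T` itself `3`-peripheral, so the new leaf is
    -- one of the three, and its neighbor `v` is one step closer to the other two.
    have hN : T.diam ≤ (addLeaf T v).diam := by
      have := dist_le_diam_of_connected (addLeaf_connected hT.connected v) (some a) (some b)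
      rwa [dist_addLeaf hT.connected, Option.elim, hab] at this
    have hsucc : ∀ s t : V, (addLeaf T v).dist (some s) (some t) = (addLeaf T v).diam →
        (addLeaf T v).dist (some s) none = (addLeaf T v).diam →
        (addLeaf T v).dist (some t) none = (addLeaf T v).diam → IsWeakDist T.dist T.diam := by
      intro s t e1 e2 e3
      simp only [dist_addLeaf hT.connected, Option.elim] at e1 e2 e3
      have := hle s t
      exact .inr (.inl ⟨by omega, s, t, v, by omega, by omega, by omega⟩)
    rcases x with _ | x <;> rcases y with _ | y <;> rcases z with _ | z
    · exact absurd rfl hxy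
    · exact absurd rfl hxy
    · exact absurd rfl hxz
    · exact hsucc y z h3 (by rw [SimpleGraph.dist_comm, h1]) (by rw [SimpleGraph.dist_comm, h2])
    · exact absurd rfl hyz
    · exact hsucc x z h2 h1 (by rw [SimpleGraph.dist_comm, h3])
    · exact hsucc x y h1 h2 h3
    · simp only [dist_addLeaf hT.connected, Option.elim] at h1 h2 h3
      have := hle x y
      exact absurd ⟨x, y, z, fun e => hxy (by rw [e]), fun e => hxz (by rw [e]),
        fun e => hyz (by rw [e]), by omega, by omega, by omega⟩ h0
  · have key : ∀ u u', T.dist u u' = T.diam → 2 ≤ T.diam ∧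
        ∃ p, T.dist u p + 1 = T.diam ∧ T.dist u' p = T.diam := by
      intro u u' huu'
      obtain ⟨x, y, z, hxy, hxz, hyz, h1, h2, h3⟩ := isPeripheral_three_iff.1
        (hodd hn u ((isPeripheralVertex_iff hT.connected u).2 ⟨u', huu'⟩))
      have hN := removeFar_diam hT huu' hpos
      rw [(removeFar_spec hT u _ _).2] at h1 h2 h3
      obtain ⟨x, hx⟩ := x
      obtain ⟨y, hy⟩ := y
      obtain ⟨z, hz⟩ := z
      simp only [Set.mem_ofPred_eq] at hx hy hz h1 h2 h3
      have hne : T.dist x y ≠ 0 := fun e => hxy (Subtype.ext (hM.eq_of_zero e))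
      refine ⟨by omega, ?_⟩
      have hu : ∀ x y, T.dist u x ≠ T.diam → T.dist u y ≠ T.diam → T.dist x y + 1 = T.diam →
          (T.dist u x + 1 = T.diam ∧ T.dist u' y = T.diam) ∨
            (T.dist u y + 1 = T.diam ∧ T.dist u' x = T.diam) := by
        intro x y hx hy hxy
        have := hM.fourPoint u u' x y
        have := hle u x
        have := hle u y
        have := hle u' x
        have := hle u' y
        omega
      -- Each pair has one vertex almost opposite to `u` and the other opposite to `u'`. Orienting
      -- the three pairs accordingly, some vertex plays both roles.
      have k1 := hu x y hx hy (by omega)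
      have k2 := hu x z hx hz (by omega)
      have k3 := hu y z hy hz (by omega)
      by_cases e1 : T.dist u x + 1 = T.diam ∧ T.dist u' x = T.diam
      · exact ⟨x, e1⟩
      by_cases e2 : T.dist u y + 1 = T.diam ∧ T.dist u' y = T.diam
      · exact ⟨y, e2⟩
      exact ⟨z, by omega⟩
    obtain ⟨k, hk⟩ := hn
    have := (key a b hab).1
    exact .inr (.inr ⟨by omega, fun u u' h => (key u u' h).2⟩)

theorem IsStronglyNonThreePeripheral.exists_isStrongPair (hT : T.IsTree)
    (h : IsStronglyNonThreePeripheral T) (hP2 : ¬ IsP2 T) :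
    ∃ u u', IsStrongPair T.dist T.diam u u' := by
  have hM := IsTreeDist.dist_of_isTree hT
  have hle := dist_le_diam_of_connected hT.connected
  have hpos := diam_pos hT.connected
  rw [isP2_iff_diam_eq_one hT] at hP2
  obtain ⟨h0, hodd, heven⟩ := h
  have ne_of : ∀ {x y : V}, T.dist x y ≠ 0 → x ≠ y := by
    rintro x y h rfl
    exact h dist_self
  rw [isPeripheral_three_iff] at h0
  rcases Nat.even_or_odd T.diam with hn | hn
  · obtain ⟨u, u', huu'⟩ := T.exists_dist_eq_diam
    refine ⟨u, u', huu', hle, ?_, ?_, ?_⟩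
    · intro p h1 h2
      exact h0 ⟨u, u', p, ne_of (by omega), ne_of (by omega), ne_of (by omega), huu', h1, h2⟩
    · intro p h1 h2
      obtain ⟨k, hk⟩ := hn
      obtain ⟨l, hl⟩ := hM.parity u u' p
      omega
    · intro p h1 h2
      refine heven hn p (isPeripheral_three_iff.2 ?_)
      -- The leaf at `p` does not increase the diameter, so with `u` and `u'` it forms a peripheral
      -- triple.
      have hp : ∀ x, T.dist x p + 1 ≤ T.diam := by
        intro x
        have := hM.fourPoint x p u u'
        have := hle x u
        have := hle x u'
        have := hle x p
        have := T.dist_comm (u := u) (v := p)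
        have := T.dist_comm (u := u') (v := p)
        omega
      have hsome : ∀ x (z : Option V), (addLeaf T p).dist (some x) z ≤ T.diam := by
        rintro x (_ | z) <;> rw [dist_addLeaf hT.connected]
        · exact hp x
        · exact hle x z
      have hdiam : (addLeaf T p).diam = T.diam := by
        refine diam_eq_of_forall_le (addLeaf_connected hT.connected p) (x := some u)
          (y := some u') ?_ ?_
        · rwa [dist_addLeaf hT.connected]
        · rintro (_ | x) z
          · rcases z with _ | z
            · simp
            · rw [SimpleGraph.dist_comm]; exact hsome _ _
          · exact hsome _ _
      refine ⟨some u, some u', none, ?_, by simp, by simp, ?_⟩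
      · simpa using ne_of (x := u) (y := u') (by omega)
      · rw [dist_addLeaf hT.connected, dist_addLeaf hT.connected, dist_addLeaf hT.connected, hdiam]
        exact ⟨huu', h1, h2⟩
  · obtain ⟨u, hu, hnot⟩ := hodd hn
    obtain ⟨u', huu'⟩ := (isPeripheralVertex_iff hT.connected u).1 hu
    obtain ⟨k, hk⟩ := hn
    refine ⟨u, u', huu', hle, ?_, ?_, ?_⟩
    · intro p h1 h2
      obtain ⟨l, hl⟩ := hM.parity u u' p
      omega
    · intro p h1 h2
      refine hnot (isPeripheral_three_iff.2 ?_)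
      -- With `w` the neighbor of `u'` towards `u`, parity forces `T.dist p w = T.diam - 1`, so `u,
      -- p, w` is a peripheral triple after the removal.
      obtain ⟨w, hw1, hw2⟩ := hM.between (x := u) (y := u') (s := T.diam - 1) (by omega)
      have hN := removeFar_diam hT huu' hpos
      have e1 := hM.triangle p w u'
      have e2 := T.dist_comm (u := u') (v := p)
      have e3 := hle p w
      obtain ⟨l, hl⟩ := hM.parity u p w
      have e4 : T.dist p w + 1 = T.diam := by omega
      refine ⟨⟨u, ?_⟩, ⟨p, ?_⟩, ⟨w, ?_⟩, ?_, ?_, ?_, ?_, ?_, ?_⟩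
      · simp only [Set.mem_ofPred_eq, dist_self]; omega
      · simp only [Set.mem_ofPred_eq]; omega
      · simp only [Set.mem_ofPred_eq]; omega
      · exact fun e => ne_of (x := u) (y := p) (by omega) (congrArg Subtype.val e)
      · exact fun e => ne_of (x := u) (y := w) (by omega) (congrArg Subtype.val e)
      · exact fun e => ne_of (x := p) (y := w) (by omega) (congrArg Subtype.val e)
      all_goals
        rw [(removeFar_spec hT u _ _).2]
        simp only
        omega
    · intro p h1 h2
      obtain ⟨l, hl⟩ := hM.parity u u' p
      omega

end Peripheral

end Graph

end AntiVdW

theorem theorem1p3 {V W : Type*} [Finite V] [Finite W] [Nontrivial V] [Nontrivial W]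
    (T : SimpleGraph V) (T' : SimpleGraph W) (hT : T.IsTree) (hT' : T'.IsTree)
    (hdiam : Even (T □ T').diam) :
    ((AntiVdW.IsWeaklyNonThreePeripheral T ∨ AntiVdW.IsWeaklyNonThreePeripheral T' ∨
        AntiVdW.IsP2 T ∨ AntiVdW.IsP2 T') →
      AntiVdW.aw (T □ T') 3 = 3) ∧
    ((AntiVdW.IsStronglyNonThreePeripheral T ∧ AntiVdW.IsStronglyNonThreePeripheral T' ∧
        ¬ AntiVdW.IsP2 T ∧ ¬ AntiVdW.IsP2 T') →
      AntiVdW.aw (T □ T') 3 = 4) := by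
  have hd := AntiVdW.IsTreeDist.dist_of_isTree hT
  have hd' := AntiVdW.IsTreeDist.dist_of_isTree hT'
  have hC := hT.connected.boxProd hT'.connected
  have hdist : (T □ T').dist = AntiVdW.prodDist T.dist T'.dist :=
    funext₂ (AntiVdW.dist_boxProd hT.connected hT'.connected)
  rw [AntiVdW.diam_boxProd hT.connected hT'.connected] at hdiam
  obtain ⟨a, b, hab⟩ := T.exists_dist_eq_diam
  obtain ⟨a', b', hab'⟩ := T'.exists_dist_eq_diam
  have hle := AntiVdW.dist_le_diam_of_connected hT.connected
  have hle' := AntiVdW.dist_le_diam_of_connected hT'.connected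
  rw [← hab] at hle
  rw [← hab'] at hle'
  have hV := AntiVdW.exists_dist_eq_one hT
  have hW := AntiVdW.exists_dist_eq_one hT'
  constructor
  · intro h
    have hweak : AntiVdW.IsWeakDist T.dist T.diam ∨ AntiVdW.IsWeakDist T'.dist T'.diam := by
      rcases h with h | h | h | h
      · exact .inl (h.isWeakDist hT)
      · exact .inr (h.isWeakDist hT')
      · exact .inl (.inl ((AntiVdW.isP2_iff_diam_eq_one hT).1 h))
      · exact .inr (.inl ((AntiVdW.isP2_iff_diam_eq_one hT').1 h))
    rw [← hab, ← hab'] at hweak hdiam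
    refine AntiVdW.aw_eq_three fun c hc => ?_
    by_contra hn
    rw [AntiVdW.not_hasRainbowAP_iff hC, hdist] at hn
    exact AntiVdW.not_noRainbow_of_isWeakDist hd hd' hV hW hle hle' hdiam hweak hc hn
  · rintro ⟨h, h', hP, hP'⟩
    refine AntiVdW.aw_eq_four (fun c hc => ?_) ?_
    · by_contra hn
      rw [AntiVdW.not_hasRainbowAP_iff hC, hdist] at hn
      exact AntiVdW.not_noRainbow_of_fourColors hd hd' hV hW hle hc hn
    · obtain ⟨u, u', hu⟩ := h.exists_isStrongPair hT hP
      obtain ⟨v, v', hv⟩ := h'.exists_isStrongPair hT' hP'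
      obtain ⟨c, hc, hn⟩ := AntiVdW.exists_noRainbow_of_isStrongPair hd hd' hu hv hdiam
      exact ⟨c, hc, by rwa [AntiVdW.not_hasRainbowAP_iff hC, hdist]⟩
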